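/- A two-qubit state is a positive semidefinite complex $4\times4$ matrix of trace $1$ acting on $\mathbb{C}^2\otimes\mathbb{C}^2$. It is separable if it is a finite convex combination of product states $\alpha\otimes\beta$, with $\alpha,\beta$ one-qubit states, and entangled otherwise. For a two-qubit state $\rho$ let $\lambda_1\ge\lambda_2\ge\lambda_3\ge\lambda_4\ge0$ be the square roots of the eigenvalues, counted with algebraic multiplicity, of $\rho(\sigma_y\otimes\sigma_y)\rho^*(\sigma_y\otimes\sigma_y)$, where $\rho^*$ is the entrywise complex conjugate of $\rho$ in the standard product basis and $\sigma_y=\begin{pmatrix}0&-i\\ i&0\end{pmatrix}$. Put $\Lambda(\rho)=\lambda_1-\lambda_2-\lambda_3-\lambda_4$, and let $C(\rho)=\max\{\Lambda(\rho),0\}$ be the concurrence of $\rho$. **Theorem 1.** For every separable two-qubit state $\rho$, the negative entanglement measure $$N(\rho)=-\inf\Big\{\,t\,C(\sigma)\;:\;t>0,\ \sigma\text{ an entangled two-qubit state},\ C\Big(\frac{\rho+t\sigma}{1+t}\Big)>0\Big\}$$ is well defined (the set on the right is nonempty and bounded below), and $$N(\rho)=\Lambda(\rho).$$ -/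

import Mathlib

open scoped ComplexOrder Kronecker

noncomputable section

namespace TwoQubit

/-- Complex matrices acting on the two-qubit space `ℂ² ⊗ ℂ²`, written in the product basis
`|00⟩, |01⟩, |10⟩, |11⟩`, which is indexed by `Fin 2 × Fin 2`. -/
abbrev Op : Type := Matrix (Fin 2 × Fin 2) (Fin 2 × Fin 2) ℂ

/-- Density matrices: positive semidefinite (in particular Hermitian) with trace one. -/
def IsState {ι : Type} [Fintype ι] (ρ : Matrix ι ι ℂ) : Prop :=
  ρ.PosSemidef ∧ ρ.trace = 1

/-- Separable two-qubit states: finite convex combinations of products of one-qubit states. -/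
def IsSeparable (ρ : Op) : Prop :=
  ∃ (n : ℕ) (p : Fin n → ℝ) (α β : Fin n → Matrix (Fin 2) (Fin 2) ℂ),
    (∀ i, 0 ≤ p i) ∧ ∑ i, p i = 1 ∧ (∀ i, IsState (α i)) ∧ (∀ i, IsState (β i)) ∧
      ρ = ∑ i, p i • (α i ⊗ₖ β i)

/-- Entangled two-qubit states: the states that are not separable. -/
def IsEntangled (σ : Op) : Prop :=
  IsState σ ∧ ¬ IsSeparable σ

/-- The Pauli matrix `σ_y`. -/
def sigmaY : Matrix (Fin 2) (Fin 2) ℂ :=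
  !![0, -Complex.I; Complex.I, 0]

/-- The matrix `ρ (σ_y ⊗ σ_y) ρ* (σ_y ⊗ σ_y)`, where `ρ*` is the entrywise complex conjugate
of `ρ` in the product basis. -/
def spinFlipProduct (ρ : Op) : Op :=
  ρ * (sigmaY ⊗ₖ sigmaY) * ρ.map star * (sigmaY ⊗ₖ sigmaY)

/-- The square roots of the four eigenvalues of `ρ (σ_y ⊗ σ_y) ρ* (σ_y ⊗ σ_y)`, counted with
algebraic multiplicity and listed in decreasing order. For a state `ρ` these eigenvalues are real
and nonnegative, since the matrix is a product of two positive semidefinite ones. -/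
def sqrtEigenvalues (ρ : Op) : List ℝ :=
  ((spinFlipProduct ρ).charpoly.roots.map fun z => √z.re).sort (· ≥ ·)

/-- `lam ρ 0 ≥ lam ρ 1 ≥ lam ρ 2 ≥ lam ρ 3` are the entries of `sqrtEigenvalues ρ`, a list of
length four. -/
def lam (ρ : Op) (i : Fin 4) : ℝ :=
  (sqrtEigenvalues ρ).getD i 0

/-- `Λ(ρ) = λ₁ - λ₂ - λ₃ - λ₄`. -/
def Lam (ρ : Op) : ℝ :=
  lam ρ 0 - lam ρ 1 - lam ρ 2 - lam ρ 3

/-- The concurrence `C(ρ) = max {Λ(ρ), 0}` of a two-qubit state. -/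
def concurrence (ρ : Op) : ℝ :=
  max (Lam ρ) 0

/-- The mixture `(ρ + t σ) / (1 + t)`. -/
def mix (ρ σ : Op) (t : ℝ) : Op :=
  (1 + t)⁻¹ • (ρ + t • σ)

/-- The set of all values `t C(σ)`, where `t > 0` and `σ` is an entangled two-qubit state such
that `C((ρ + t σ) / (1 + t)) > 0`. -/
def costSet (ρ : Op) : Set ℝ :=
  {x | ∃ (t : ℝ) (σ : Op), 0 < t ∧ IsEntangled σ ∧ 0 < concurrence (mix ρ σ t) ∧
    x = t * concurrence σ}

/-- The negative entanglement measure `N(ρ)`. -/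
def negEntanglement (ρ : Op) : ℝ :=
  - sInf (costSet ρ)

end TwoQubit

end

/-!
Write `S = σ_y ⊗ σ_y`. If `ρ = X Xᴴ`, the numbers `λ` are the singular values of the complex
symmetric matrix `Xᵀ S X`, up to zeros. By the Takagi factorization (`takagi`), `X` may be
multiplied by a unitary so that `Xᵀ S X` becomes the diagonal matrix of the `λ`s (`Lam_eq`).

The heart of the matter is that `Λ` is sublinear on positive semidefinite matrices, also where it
is negative (`Lam_add_le`). For an eigenframe `Z` of `A + B` with diagonal `d`, write `A = Z P Zᴴ`
and `B = Z (1 - P) Zᴴ`. The functional sending `Z P Zᴴ` to the trace of `d P` weighted by `+1` at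
the largest `d` and `-1` elsewhere equals `Λ` at `A + B`, and it is at most `Λ` at `A` and at `B`.
The latter amounts to an inequality for the rows of a matrix `N` with `Nᵀ N` diagonal
(`row_inequality`), of the kind of Mirsky's theorem for a rank-one perturbation; an explicit
quadratic form with unitary matrix proves it (`exists_quadratic_form`).

Product states have four equal `λ`s, hence `Λ ≤ 0` on separable states. If `Λ(ρ + t σ) > 0`,
sublinearity gives `t C(σ) ≥ -Λ(ρ)`. Conversely, adding to `ρ` a multiple of the pure state of its
leading column raises `Λ` by exactly the concurrence added (`exists_Lam_add_eq`), so `-Λ(ρ)` is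
approached; if all `λ`s of `ρ` vanish, a small multiple of the identity is added as well. The
states used are entangled because `Λ` becomes positive.
-/

open scoped ComplexOrder Kronecker
open Matrix

namespace TwoQubit

/-! ### Takagi factorization -/

/-- If `μ` is an eigenvalue of `T̄ T` on `W` and `s = √μ`, then `star (T u) + s u` is a
coneigenvector of `T` for every eigenvector `u`; when it vanishes, `i u` is one. -/
theorem exists_coneigenvector {ι : Type*} [Fintype ι] (T : Matrix ι ι ℂ) (hT : Tᵀ = T)
    (W : Submodule ℂ (ι → ℂ)) (hW : W ≠ ⊥) (hinv : ∀ u ∈ W, star (T *ᵥ u) ∈ W) :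
    ∃ w ∈ W, star w ⬝ᵥ w = 1 ∧ ∃ d : ℝ, 0 ≤ d ∧ T *ᵥ w = (d : ℂ) • star w := by
  classical
  -- The square of the antilinear map `u ↦ star (T *ᵥ u)` is linear.
  let f : (ι → ℂ) →ₗ[ℂ] (ι → ℂ) := (T.map star * T).mulVecLin
  have hsq : ∀ u, f u = star (T *ᵥ star (T *ᵥ u)) := by
    intro u
    simp only [f, mulVecLin_apply, ← mulVec_mulVec]
    ext i
    simp [mulVec, dotProduct]
  have hf : ∀ u ∈ W, f u ∈ W := fun u hu => by
    rw [hsq]; exact hinv _ (hinv _ hu)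
  have : Nontrivial W := Submodule.nontrivial_iff_ne_bot.mpr hW
  obtain ⟨μ, hμ⟩ := Module.End.exists_eigenvalue (f.restrict hf)
  obtain ⟨u', hu'⟩ := hμ.exists_hasEigenvector
  obtain ⟨u, hu⟩ := u'
  have hu0 : u ≠ 0 := fun h => hu'.2 (by simp [h])
  have hfu : f u = μ • u := by
    have := congrArg Subtype.val hu'.apply_eq_smul
    simpa using this
  have hpos : 0 < star u ⬝ᵥ u := dotProduct_star_self_pos_iff.mpr hu0
  have hnn : 0 ≤ μ := by
    have h1 : star u ⬝ᵥ f u = star (T *ᵥ u) ⬝ᵥ (T *ᵥ u) := by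
      rw [hsq, star_dotProduct_star, dotProduct_comm, dotProduct_mulVec,
        ← mulVec_transpose, hT, dotProduct_comm]
      simp [dotProduct, mul_comm]
    rw [hfu, dotProduct_smul, smul_eq_mul] at h1
    have h2 : 0 ≤ μ * (star u ⬝ᵥ u) := h1 ▸ dotProduct_star_self_nonneg _
    obtain ⟨p1, p2⟩ := Complex.lt_def.mp hpos
    obtain ⟨q1, q2⟩ := Complex.le_def.mp h2
    simp only [Complex.zero_re, Complex.zero_im, Complex.mul_re, Complex.mul_im] at p1 p2 q1 q2
    rw [← p2, mul_zero, sub_zero] at q1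
    rw [← p2, mul_zero, zero_add] at q2
    rw [Complex.le_def]
    exact ⟨nonneg_of_mul_nonneg_left q1 p1, by simpa [p1.ne', eq_comm] using q2⟩
  obtain ⟨r, hr, rfl⟩ : ∃ r : ℝ, 0 ≤ r ∧ (r : ℂ) = μ :=
    ⟨μ.re, (Complex.le_def.mp hnn).1, by
      apply Complex.ext <;> simp [← (Complex.le_def.mp hnn).2]⟩
  set s := √r with hs
  have hss : (s : ℂ) * s = r := by
    rw [← Complex.ofReal_mul, Real.mul_self_sqrt hr]
  suffices h : ∃ w ∈ W, w ≠ 0 ∧ T *ᵥ w = (s : ℂ) • star w by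
    obtain ⟨w, hw, hw0, hTw⟩ := h
    have hp : 0 < star w ⬝ᵥ w := dotProduct_star_self_pos_iff.mpr hw0
    obtain ⟨c, hc, hcw⟩ : ∃ c : ℝ, 0 < c ∧ (c : ℂ) = star w ⬝ᵥ w :=
      ⟨(star w ⬝ᵥ w).re, (Complex.lt_def.mp hp).1, by
        apply Complex.ext <;> simp [← (Complex.lt_def.mp hp).2]⟩
    have hcc : ((√c : ℝ) : ℂ) * (√c : ℝ) = c := by
      rw [← Complex.ofReal_mul, Real.mul_self_sqrt hc.le]
    have hc0 : ((√c : ℝ) : ℂ) ≠ 0 := by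
      simpa using (Real.sqrt_pos.mpr hc).ne'
    refine ⟨((√c : ℝ) : ℂ)⁻¹ • w, W.smul_mem _ hw, ?_, s, Real.sqrt_nonneg _, ?_⟩
    · rw [star_smul, smul_dotProduct, dotProduct_smul, ← hcw, ← hcc]
      simp [hc0]
    · rw [mulVec_smul, hTw, star_smul, smul_comm]
      simp
  by_cases hw : star (T *ᵥ u) + (s : ℂ) • u = 0
  · refine ⟨Complex.I • u, W.smul_mem _ hu, by simp [hu0], ?_⟩
    have h1 : T *ᵥ u = -((s : ℂ) • star u) := by
      have := congrArg star (eq_neg_of_add_eq_zero_left hw)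
      simpa using this
    rw [mulVec_smul, h1, star_smul, smul_comm (s : ℂ)]
    simp
  · refine ⟨_, W.add_mem (hinv _ hu) (W.smul_mem _ hu), hw, ?_⟩
    have h1 : T *ᵥ star (T *ᵥ u) = (r : ℂ) • star u := by
      have := congrArg star ((hsq u).symm.trans hfu)
      simpa using this
    rw [mulVec_add, mulVec_smul, h1, star_add, star_smul, star_star, smul_add, smul_smul,
      add_comm, ← hss]
    simp

/-- Coneigenvectors can be chosen one at a time: since `T` is symmetric, the orthogonal complement
of those already found is invariant under `u ↦ star (T u)`. -/
theorem takagi_partial {ι : Type*} [Fintype ι] (T : Matrix ι ι ℂ) (hT : Tᵀ = T) (k : ℕ)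
    (hk : k ≤ Fintype.card ι) :
    ∃ (v : Fin k → ι → ℂ) (d : Fin k → ℝ),
      (∀ i j, star (v i) ⬝ᵥ v j = if i = j then 1 else 0) ∧
      ∀ j, 0 ≤ d j ∧ T *ᵥ v j = (d j : ℂ) • star (v j) := by
  classical
  induction k with
  | zero => exact ⟨Fin.elim0, Fin.elim0, fun i => i.elim0, fun i => i.elim0⟩
  | succ k ih =>
    obtain ⟨v, d, hv, hd⟩ := ih (by omega)
    let f : (ι → ℂ) →ₗ[ℂ] (Fin k → ℂ) := (Matrix.of fun i => star (v i)).mulVecLin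
    have hmem : ∀ u, u ∈ LinearMap.ker f ↔ ∀ i, star (v i) ⬝ᵥ u = 0 := fun u => by
      rw [LinearMap.mem_ker]
      exact ⟨fun h i => congrFun h i, fun h => funext h⟩
    have hker : LinearMap.ker f ≠ ⊥ := LinearMap.ker_ne_bot_of_finrank_lt (by simp; omega)
    obtain ⟨w, hw, hw1, e, he, hTw⟩ := exists_coneigenvector T hT _ hker (by
      intro u hu
      rw [hmem] at hu ⊢
      intro i
      rw [star_dotProduct_star, dotProduct_comm, dotProduct_mulVec, ← mulVec_transpose, hT,
        (hd i).2, smul_dotProduct, hu i]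
      simp)
    rw [hmem] at hw
    refine ⟨Fin.cons w v, Fin.cons e d, ?_, ?_⟩
    · intro i j
      refine Fin.cases ?_ (fun i => ?_) i <;> refine Fin.cases ?_ (fun j => ?_) j
      · simpa using hw1
      · simp only [Fin.cons_zero, Fin.cons_succ]
        have h0 := congrArg star (hw j)
        rw [← star_dotProduct_star, star_star] at h0
        simpa [(Fin.succ_ne_zero j).symm] using h0
      · simpa [Fin.succ_ne_zero] using hw i
      · simpa using hv i j
    · intro j
      refine Fin.cases ?_ (fun j => ?_) j
      · simpa using ⟨he, hTw⟩
      · simpa using hd j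

/-- **Takagi factorization** of a complex symmetric matrix; the `d i` are its singular values. -/
theorem takagi {ι : Type*} [Fintype ι] [DecidableEq ι] (T : Matrix ι ι ℂ) (hT : Tᵀ = T) :
    ∃ (V : Matrix ι ι ℂ) (d : ι → ℝ), Vᴴ * V = 1 ∧ (∀ i, 0 ≤ d i) ∧
      Vᵀ * T * V = diagonal fun i => (d i : ℂ) := by
  obtain ⟨v, d, hv, hd⟩ := takagi_partial T hT _ le_rfl
  let e := Fintype.equivFin ι
  refine ⟨(Matrix.of fun j => v (e j))ᵀ, fun j => d (e j), ?_, fun j => (hd _).1, ?_⟩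
  · ext i j
    have h1 := hv (e i) (e j)
    simp only [e.injective.eq_iff] at h1
    rw [one_apply, ← h1]
    simp [mul_apply, dotProduct]
  · ext i j
    have h1 := hv (e j) (e i)
    have h2 : ((of fun j => v (e j))ᵀᵀ * T * (of fun j => v (e j))ᵀ) i j
        = v (e i) ⬝ᵥ (T *ᵥ v (e j)) := by
      rw [Matrix.mul_assoc]
      simp [mul_apply, dotProduct, mulVec]
    rw [h2, (hd _).2, dotProduct_smul, dotProduct_comm, h1, diagonal_apply]
    rcases eq_or_ne i j with rfl | hij
    · simp
    · simp [hij, hij.symm]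

/-! ### Reading off `Λ` from a factorization -/

/-- `Λ` is twice the largest of the `λ`s minus their sum, so it can be read off any nonnegative
family that agrees with them up to added zeros. -/
theorem Lam_eq_of_roots (ρ : Op) {ι : Type*} [Fintype ι] (d : ι → ℝ) (hd : ∀ i, 0 ≤ d i)
    (j : ι) (hj : ∀ i, d i ≤ d j) (m k : ℕ)
    (h : Multiset.replicate m 0 + (spinFlipProduct ρ).charpoly.roots.map (fun z => √z.re)
      = Multiset.replicate k 0 + Finset.univ.val.map d) :
    Lam ρ = 2 * d j - ∑ i, d i := by
  set M := (spinFlipProduct ρ).charpoly.roots.map (fun z => √z.re) with hM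
  have hcoe : (sqrtEigenvalues ρ : Multiset ℝ) = M := Multiset.sort_eq _ _
  have hsorted : (sqrtEigenvalues ρ).Pairwise (· ≥ ·) := Multiset.pairwise_sort _ _
  have hlen : (sqrtEigenvalues ρ).length = 4 := by
    rw [← Multiset.coe_card, hcoe, hM, Multiset.card_map, IsAlgClosed.card_roots_eq_natDegree,
      charpoly_natDegree_eq_dim]
    simp
  obtain ⟨a, b, c, e, hl⟩ : ∃ a b c e, sqrtEigenvalues ρ = [a, b, c, e] := by
    rcases hl : sqrtEigenvalues ρ with _ | ⟨a, _ | ⟨b, _ | ⟨c, _ | ⟨e, _ | ⟨f, l⟩⟩⟩⟩⟩ <;>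
      simp [hl] at hlen
    exact ⟨a, b, c, e, rfl⟩
  rw [← hcoe, hl] at h
  rw [hl] at hsorted
  have hLam : Lam ρ = a - b - c - e := by simp [Lam, lam, hl]
  have hsum : a + b + c + e = ∑ i, d i := by
    have := congrArg Multiset.sum h
    simp at this
    rw [← this]; ring
  have ha0 : 0 ≤ a := by
    have : a ∈ M := by rw [← hcoe, hl]; simp
    obtain ⟨z, -, hz⟩ := Multiset.mem_map.mp this
    exact hz ▸ Real.sqrt_nonneg _
  have h1 : a ≤ d j := by
    have : a ∈ Multiset.replicate k (0 : ℝ) + Finset.univ.val.map d := by rw [← h]; simp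
    rcases Multiset.mem_add.mp this with h0 | h0
    · rw [Multiset.eq_of_mem_replicate h0]; exact hd j
    · obtain ⟨i, -, hi⟩ := Multiset.mem_map.mp h0
      exact hi ▸ hj i
  have h2 : d j ≤ a := by
    have : d j ∈ Multiset.replicate m (0 : ℝ) + (([a, b, c, e] : List ℝ) : Multiset ℝ) := by
      rw [h]; simp
    rcases Multiset.mem_add.mp this with h0 | h0
    · rw [Multiset.eq_of_mem_replicate h0]; exact ha0
    · simp at hsorted
      simp at h0
      rcases h0 with h0 | h0 | h0 | h0 <;> linarith [hsorted.1.1, hsorted.1.2.1, hsorted.1.2.2]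
  rw [hLam, ← hsum]
  linarith

/-- The spin-flip matrix `σ_y ⊗ σ_y`. -/
abbrev spinFlip : Op := sigmaY ⊗ₖ sigmaY

theorem sigmaY_transpose : sigmaYᵀ = -sigmaY := by
  ext i j; fin_cases i <;> fin_cases j <;> simp [sigmaY]

theorem sigmaY_map_star : sigmaY.map star = -sigmaY := by
  ext i j; fin_cases i <;> fin_cases j <;> simp [sigmaY]

theorem sigmaY_mul_self : sigmaY * sigmaY = 1 := by
  ext i j; fin_cases i <;> fin_cases j <;> simp [sigmaY, mul_apply]

theorem spinFlip_transpose : spinFlipᵀ = spinFlip := by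
  ext i j
  have h : ∀ i j, sigmaY j i = -sigmaY i j := fun i j => congrFun (congrFun sigmaY_transpose i) j
  exact (congrArg₂ (· * ·) (h i.1 j.1) (h i.2 j.2)).trans (neg_mul_neg _ _)

theorem spinFlip_map_star : spinFlip.map star = spinFlip := by
  ext i j
  have h : ∀ i j, star (sigmaY i j) = -sigmaY i j :=
    fun i j => congrFun (congrFun sigmaY_map_star i) j
  exact (star_mul' _ _).trans ((congrArg₂ (· * ·) (h i.1 j.1) (h i.2 j.2)).trans (neg_mul_neg _ _))

theorem spinFlip_mul_self : spinFlip * spinFlip = 1 := by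
  rw [spinFlip, ← mul_kronecker_mul, sigmaY_mul_self, one_kronecker_one]

theorem map_star_mul {l m n : Type*} [Fintype m] (A : Matrix l m ℂ) (B : Matrix m n ℂ) :
    (A * B).map star = A.map star * B.map star := by
  ext i j
  simp [mul_apply]

theorem spinFlipProduct_mul_conjTranspose {ι : Type*} [Fintype ι] [DecidableEq ι]
    (Z : Matrix (Fin 2 × Fin 2) ι ℂ) :
    spinFlipProduct (Z * Zᴴ) = Z * ((Zᵀ * spinFlip * Z).map star * (Zᵀ * spinFlip)) := by
  have h : (Z * Zᴴ).map star = Z.map star * Zᵀ := by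
    rw [map_star_mul]; congr 1; ext; simp
  have h' : Zᵀ.map star = Zᴴ := rfl
  rw [spinFlipProduct, h, map_star_mul, map_star_mul, h', spinFlip_map_star]
  simp only [Matrix.mul_assoc]

/-- `Λ` in a decomposition `ρ = Z Zᴴ` whose columns are orthogonal for the symmetric bilinear form
of the spin flip: the diagonal entries `d` are the `λ`s, up to zeros when `Z` is not square. -/
theorem Lam_eq {ι : Type*} [Fintype ι] [DecidableEq ι] (Z : Matrix (Fin 2 × Fin 2) ι ℂ)
    (d : ι → ℝ) (hd : ∀ i, 0 ≤ d i) (hZ : Zᵀ * spinFlip * Z = diagonal fun i => (d i : ℂ))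
    (j : ι) (hj : ∀ i, d i ≤ d j) :
    Lam (Z * Zᴴ) = 2 * d j - ∑ i, d i := by
  have hB : (Zᵀ * spinFlip * Z).map star * (Zᵀ * spinFlip) * Z =
      diagonal fun i => ((d i ^ 2 : ℝ) : ℂ) := by
    rw [Matrix.mul_assoc, hZ, diagonal_map (by simp), diagonal_mul_diagonal]
    simp [sq]
  have h := charpoly_mul_comm' Z ((Zᵀ * spinFlip * Z).map star * (Zᵀ * spinFlip))
  rw [hB, ← spinFlipProduct_mul_conjTranspose, charpoly_diagonal] at h
  have h2 := congrArg (fun p => p.roots.map fun z : ℂ => √z.re) h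
  have hX : ∀ k : ℕ, (Polynomial.X ^ k : Polynomial ℂ) ≠ 0 := fun k =>
    pow_ne_zero _ Polynomial.X_ne_zero
  rw [Polynomial.roots_mul (mul_ne_zero (hX _) (charpoly_monic _).ne_zero),
    Polynomial.roots_mul (mul_ne_zero (hX _) (Polynomial.monic_prod_X_sub_C _ _).ne_zero),
    Polynomial.roots_prod _ _ (Polynomial.monic_prod_X_sub_C _ _).ne_zero] at h2
  refine Lam_eq_of_roots _ d hd j hj (Fintype.card ι) (Fintype.card (Fin 2 × Fin 2)) ?_
  simpa [-Complex.ofReal_pow, Polynomial.roots_X_pow, Multiset.nsmul_singleton,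
    Multiset.map_replicate, Multiset.bind_singleton, Multiset.map_add, Real.sqrt_sq, hd] using h2

/-! ### The row inequality -/

/-- A quadratic form `∑ x² - γ (e ⬝ x)²`, a rank-one modification of `∑ x²`, which is bounded by the
squared norm and takes the value `-‖q‖²` at a prescribed vector `q`. Writing `q = a + i b` with `a`,
`b` real, take `e = a / ‖a‖` and `γ = 2 / (1 + i β)` with `β = (a ⬝ b) / ‖a‖²`; the bound holds
because `‖1 - γ‖ = 1`. -/
theorem exists_quadratic_form {n : Type*} [Fintype n] (q : n → ℂ) :
    ∃ (e : n → ℝ) (γ : ℂ), ∑ k, e k ^ 2 ≤ 1 ∧ γ.re ≤ 2 ∧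
      (∀ x : n → ℂ, ‖∑ k, x k ^ 2 - γ * (∑ k, e k * x k) ^ 2‖ ≤ ∑ k, ‖x k‖ ^ 2) ∧
      ∑ k, q k ^ 2 - γ * (∑ k, e k * q k) ^ 2 = -((∑ k, ‖q k‖ ^ 2 : ℝ) : ℂ) := by
  set A := ∑ k, (q k).re ^ 2 with hA
  have hA0 : 0 ≤ A := Finset.sum_nonneg fun k _ => sq_nonneg _
  rcases hA0.eq_or_lt with h0 | hpos
  · -- If `q` is purely imaginary, the form `∑ x²` itself takes the value `-‖q‖²` at `q`.
    refine ⟨0, 0, by simp, by simp, fun x => ?_, ?_⟩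
    · simpa only [zero_mul, sub_zero] using
        (norm_sum_le Finset.univ fun k => x k ^ 2).trans_eq
          (Finset.sum_congr rfl fun k _ => _root_.norm_pow (x k) 2)
    · have hre : ∀ k, (q k).re = 0 := fun k => by
        have := (Finset.sum_eq_zero_iff_of_nonneg fun k _ => sq_nonneg (q k).re).mp h0.symm k
          (Finset.mem_univ k)
        simpa using this
      simp only [zero_mul, sub_zero]
      push_cast
      rw [← Finset.sum_neg_distrib]
      refine Finset.sum_congr rfl fun k _ => ?_
      rw [← Complex.ofReal_pow, ← Complex.normSq_eq_norm_sq, Complex.normSq_apply]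
      apply Complex.ext <;> simp [sq, hre k]
  · set α := √A with hα
    have hαpos : 0 < α := Real.sqrt_pos.mpr hpos
    have hαsq : α ^ 2 = A := Real.sq_sqrt hA0
    set e : n → ℝ := fun k => (q k).re / α with he
    have he1 : ∑ k, e k ^ 2 = 1 := by
      simp only [he, div_pow]
      rw [← Finset.sum_div, ← hA, hαsq, div_self hpos.ne']
    set β := (∑ k, e k * (q k).im) / α with hβ
    have h1β : (1 + β * Complex.I : ℂ) ≠ 0 := fun h => by simpa using congrArg Complex.re h
    have hγre : (2 / (1 + β * Complex.I) : ℂ).re = 2 / (1 + β ^ 2) := by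
      rw [Complex.div_re]
      simp [Complex.normSq_apply, sq]
    have hγ1 : ‖(1 : ℂ) - 2 / (1 + β * Complex.I)‖ = 1 := by
      have h1 : (1 : ℂ) - 2 / (1 + β * Complex.I)
          = -(starRingEnd ℂ (1 + β * Complex.I) / (1 + β * Complex.I)) := by
        field_simp
        simp
        ring
      rw [h1, norm_neg, norm_div, RCLike.norm_conj, div_self (norm_ne_zero_iff.mpr h1β)]
    refine ⟨e, 2 / (1 + β * Complex.I), he1.le, ?_, fun x => ?_, ?_⟩
    · rw [hγre, div_le_iff₀ (by positivity)]; nlinarith [sq_nonneg β]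
    · -- Split `x` into its component along `e` and a remainder orthogonal to `e`.
      set s := ∑ k, (e k : ℂ) * x k with hs
      have hsq : ∑ k, (x k - s * e k) ^ 2 = ∑ k, x k ^ 2 - s ^ 2 := by
        have h1 : ∀ k, (x k - s * e k) ^ 2
            = x k ^ 2 - 2 * s * (e k * x k) + s ^ 2 * ((e k ^ 2 : ℝ) : ℂ) := fun k => by
          push_cast; ring
        simp only [h1]
        rw [Finset.sum_add_distrib, Finset.sum_sub_distrib, ← Finset.mul_sum, ← Finset.mul_sum,
          ← hs, ← Complex.ofReal_sum, he1]
        push_cast; ring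
      have hpyth : ∑ k, ‖x k - s * e k‖ ^ 2 = ∑ k, ‖x k‖ ^ 2 - ‖s‖ ^ 2 := by
        have hre : s.re = ∑ k, e k * (x k).re := by simp [hs]
        have him : s.im = ∑ k, e k * (x k).im := by simp [hs]
        have h1 : ∀ k, ‖x k - s * e k‖ ^ 2 = ‖x k‖ ^ 2 - 2 * s.re * (e k * (x k).re)
            - 2 * s.im * (e k * (x k).im) + ‖s‖ ^ 2 * e k ^ 2 := fun k => by
          simp only [← Complex.normSq_eq_norm_sq, Complex.normSq_apply, Complex.sub_re,
            Complex.sub_im, Complex.mul_re, Complex.mul_im, Complex.ofReal_re, Complex.ofReal_im]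
          ring
        simp only [h1]
        rw [Finset.sum_add_distrib, Finset.sum_sub_distrib, Finset.sum_sub_distrib,
          ← Finset.mul_sum, ← Finset.mul_sum, ← Finset.mul_sum, ← hre, ← him, he1,
          ← Complex.normSq_eq_norm_sq s, Complex.normSq_apply]
        ring
      have hdec : ∑ k, x k ^ 2 - 2 / (1 + β * Complex.I) * s ^ 2
          = (1 - 2 / (1 + β * Complex.I)) * s ^ 2 + ∑ k, (x k - s * e k) ^ 2 := by
        rw [hsq]; ring
      rw [hdec]
      calc _ ≤ ‖(1 - 2 / (1 + β * Complex.I)) * s ^ 2‖ + ‖∑ k, (x k - s * e k) ^ 2‖ :=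
            norm_add_le _ _
        _ ≤ ‖s‖ ^ 2 + ∑ k, ‖x k - s * e k‖ ^ 2 := by
            rw [norm_mul, hγ1, one_mul, norm_pow]
            gcongr
            exact (norm_sum_le Finset.univ fun k => (x k - s * e k) ^ 2).trans_eq
              (Finset.sum_congr rfl fun k _ => _root_.norm_pow _ 2)
        _ = ∑ k, ‖x k‖ ^ 2 := by rw [hpyth]; ring
    · have heq : ∑ k, (e k : ℂ) * q k = α * (1 + β * Complex.I) := by
        apply Complex.ext
        · simp [he, div_mul_eq_mul_div, ← sq]
          rw [← Finset.sum_div, ← hA, ← hαsq]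
          field_simp
        · simp [hβ]
          field_simp
      have hab : ∑ k, (q k).re * (q k).im = α ^ 2 * β := by
        have : ∀ k, (q k).re * (q k).im = α * (e k * (q k).im) := fun k => by
          simp only [he]; field_simp
        simp only [this]
        rw [← Finset.mul_sum, hβ]
        field_simp
      have hq2 : ∑ k, q k ^ 2 = ((α ^ 2 - ∑ k, (q k).im ^ 2 : ℝ) : ℂ)
          + 2 * ((α ^ 2 * β : ℝ) : ℂ) * Complex.I := by
        rw [← hab, hαsq, hA]
        push_cast
        rw [← Finset.sum_sub_distrib, Finset.mul_sum, Finset.sum_mul, ← Finset.sum_add_distrib]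
        refine Finset.sum_congr rfl fun k _ => ?_
        apply Complex.ext <;> simp [sq]
        ring
      have hn : ∑ k, ‖q k‖ ^ 2 = α ^ 2 + ∑ k, (q k).im ^ 2 := by
        rw [hαsq, hA, ← Finset.sum_add_distrib]
        refine Finset.sum_congr rfl fun k _ => ?_
        rw [← Complex.normSq_eq_norm_sq, Complex.normSq_apply, sq, sq]
      rw [heq, hq2, hn]
      field_simp
      push_cast
      ring

/-- Only row `j` of `N` counts positively on the left, only the largest `d l` on the right. The
form of `exists_quadratic_form` for row `j` takes the value `-‖N j‖²` there and at most `‖N i‖²`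
on the other rows, while its sum over all rows depends only on `Nᵀ * N`. -/
theorem row_inequality {m n : Type*} [Fintype m] [Fintype n] [DecidableEq n]
    (N : Matrix m n ℂ) (d : n → ℝ) (hd : ∀ k, 0 ≤ d k) (l : n) (hl : ∀ k, d k ≤ d l)
    (hN : Nᵀ * N = diagonal fun k => (d k : ℂ)) (j : m) :
    2 * ∑ k, ‖N j k‖ ^ 2 - ∑ i, ∑ k, ‖N i k‖ ^ 2 ≤ 2 * d l - ∑ k, d k := by
  classical
  obtain ⟨e, γ, he, hγ2, hQ, hq⟩ := exists_quadratic_form (N j)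
  set Q : m → ℂ := fun i => ∑ k, N i k ^ 2 - γ * (∑ k, e k * N i k) ^ 2 with hQdef
  have hentry : ∀ k l, ∑ i, N i k * N i l = if k = l then (d k : ℂ) else 0 := fun k l => by
    have := congrFun (congrFun hN k) l
    simpa [mul_apply, diagonal_apply] using this
  have hsum : ∑ i, Q i = ((∑ k, d k : ℝ) : ℂ) - γ * ((∑ k, e k ^ 2 * d k : ℝ) : ℂ) := by
    simp only [hQdef]
    rw [Finset.sum_sub_distrib, ← Finset.mul_sum]
    congr 2
    · rw [Finset.sum_comm]
      push_cast
      refine Finset.sum_congr rfl fun k _ => ?_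
      simpa [sq] using hentry k k
    · simp only [sq, Finset.sum_mul_sum]
      rw [Finset.sum_comm]
      push_cast
      refine Finset.sum_congr rfl fun k _ => ?_
      rw [Finset.sum_comm]
      have : ∀ l, ∑ i, (e k : ℂ) * N i k * (e l * N i l)
          = if k = l then (e k : ℂ) * e l * d k else 0 := fun l => by
        rw [← mul_ite_zero, ← hentry, Finset.mul_sum]
        exact Finset.sum_congr rfl fun i _ => by ring
      simp [this]
  have hre : ∑ i, (Q i).re = ∑ k, d k - γ.re * ∑ k, e k ^ 2 * d k := by
    rw [← Complex.re_sum, hsum, Complex.sub_re, Complex.re_mul_ofReal, Complex.ofReal_re]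
  have hγle : γ.re * ∑ k, e k ^ 2 * d k ≤ 2 * d l := by
    have h1 : ∑ k, e k ^ 2 * d k ≤ d l := calc
      _ ≤ ∑ k, e k ^ 2 * d l := Finset.sum_le_sum fun k _ => by gcongr; exact hl k
      _ = (∑ k, e k ^ 2) * d l := by rw [Finset.sum_mul]
      _ ≤ 1 * d l := by gcongr; exact hd l
      _ = d l := one_mul _
    exact mul_le_mul hγ2 h1 (Finset.sum_nonneg fun k _ => mul_nonneg (sq_nonneg _) (hd k)) (by simp)
  have hj : (Q j).re = -∑ k, ‖N j k‖ ^ 2 := by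
    simp only [hQdef]
    rw [hq, Complex.neg_re, Complex.ofReal_re]
  have hle : ∑ i ∈ Finset.univ.erase j, (Q i).re
      ≤ ∑ i ∈ Finset.univ.erase j, ∑ k, ‖N i k‖ ^ 2 :=
    Finset.sum_le_sum fun i _ => (Complex.re_le_norm _).trans (hQ (N i))
  have h1 := Finset.add_sum_erase Finset.univ (fun i => (Q i).re) (Finset.mem_univ j)
  have h2 := Finset.add_sum_erase Finset.univ (fun i => ∑ k, ‖N i k‖ ^ 2) (Finset.mem_univ j)
  beta_reduce at h1 h2
  linarith [hγle]

/-! ### Subadditivity and homogeneity of `Λ` -/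

theorem re_mul_conjTranspose_apply {m n : Type*} [Fintype n] (N : Matrix m n ℂ) (i : m) :
    ((N * Nᴴ) i i).re = ∑ k, ‖N i k‖ ^ 2 := by
  rw [mul_apply, Complex.re_sum]
  refine Finset.sum_congr rfl fun k _ => ?_
  rw [conjTranspose_apply, ← starRingEnd_apply, Complex.mul_conj, Complex.ofReal_re,
    Complex.normSq_eq_norm_sq]

/-- Multiplying `X` by a unitary on the right keeps `X Xᴴ` and makes the columns orthogonal for the
bilinear form of the spin flip. -/
theorem exists_takagi_factor {ι : Type*} [Fintype ι] [DecidableEq ι]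
    (X : Matrix (Fin 2 × Fin 2) ι ℂ) :
    ∃ (V : Matrix ι ι ℂ) (d : ι → ℝ), V * Vᴴ = 1 ∧ (∀ i, 0 ≤ d i) ∧
      (X * V) * (X * V)ᴴ = X * Xᴴ ∧
      Vᵀ * (Xᵀ * spinFlip * X) * V = diagonal (fun i => (d i : ℂ)) ∧
      (X * V)ᵀ * spinFlip * (X * V) = diagonal fun i => (d i : ℂ) := by
  obtain ⟨V, d, hV, hd, h⟩ := takagi (Xᵀ * spinFlip * X) (by
    simp only [transpose_mul, transpose_transpose, spinFlip_transpose, Matrix.mul_assoc])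
  have hV' := mul_eq_one_comm.mp hV
  refine ⟨V, d, hV', hd, ?_, h, ?_⟩
  · rw [conjTranspose_mul, Matrix.mul_assoc, ← Matrix.mul_assoc V, hV', Matrix.one_mul]
  · rw [← h, transpose_mul]
    simp only [Matrix.mul_assoc]

/-- The lower bound for `Λ(X Xᴴ)` behind its subadditivity: the left side is linear in `N Nᴴ`. -/
theorem two_mul_sub_trace_le_Lam {ι m : Type*} [Fintype ι] [DecidableEq ι] [Nonempty ι] [Fintype m]
    (X : Matrix (Fin 2 × Fin 2) ι ℂ) (N : Matrix m ι ℂ) (hN : Nᵀ * N = Xᵀ * spinFlip * X) (j : m) :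
    2 * ((N * Nᴴ) j j).re - ∑ i, ((N * Nᴴ) i i).re ≤ Lam (X * Xᴴ) := by
  obtain ⟨V, d, hV, hd, hX, hV2, hZ⟩ := exists_takagi_factor X
  obtain ⟨l, hl⟩ := Finite.exists_max d
  have hNV : (N * V) * (N * V)ᴴ = N * Nᴴ := by
    rw [conjTranspose_mul, Matrix.mul_assoc, ← Matrix.mul_assoc V, hV, Matrix.one_mul]
  rw [← hX, Lam_eq (X * V) d hd hZ l hl, ← hNV]
  simp only [re_mul_conjTranspose_apply]
  refine row_inequality (N * V) d hd l hl ?_ j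
  rw [← hV2, ← hN, transpose_mul]
  simp only [Matrix.mul_assoc]

open scoped MatrixOrder Matrix.Norms.L2Operator in
theorem exists_eq_mul_conjTranspose {n : Type*} [Fintype n] [DecidableEq n] {A : Matrix n n ℂ}
    (hA : A.PosSemidef) : ∃ X : Matrix n n ℂ, A = X * Xᴴ := by
  obtain ⟨Y, rfl⟩ := CStarAlgebra.nonneg_iff_eq_star_mul_self.mp hA.nonneg
  exact ⟨Yᴴ, by rw [conjTranspose_conjTranspose, star_eq_conjTranspose]⟩

/-- Subadditivity of `Λ`. A Takagi factor `Z = [X Y] V` of `A + B` gives `X = Z W₁` and `Y = Z W₂`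
with `[W₁ W₂] = Vᴴ` unitary. The lower bounds for `Λ(A)` and `Λ(B)` obtained from
`N = √d W₁` and `N = √d W₂` then add up to exactly `Λ(A + B)`. -/
theorem Lam_add_le {A B : Op} (hA : A.PosSemidef) (hB : B.PosSemidef) :
    Lam (A + B) ≤ Lam A + Lam B := by
  obtain ⟨X, rfl⟩ := exists_eq_mul_conjTranspose hA
  obtain ⟨Y, rfl⟩ := exists_eq_mul_conjTranspose hB
  obtain ⟨V, d, hV, hd, hXY, -, hZ⟩ := exists_takagi_factor (fromCols X Y)
  obtain ⟨j, hj⟩ := Finite.exists_max d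
  set Z := fromCols X Y * V with hZdef
  have hsum : X * Xᴴ + Y * Yᴴ = Z * Zᴴ := by
    rw [hXY, conjTranspose_fromCols_eq_fromRows_conjTranspose, fromCols_mul_fromRows]
  obtain ⟨W₁, W₂, hW⟩ : ∃ W₁ W₂, Vᴴ = fromCols W₁ W₂ := ⟨_, _, (fromCols_toCols Vᴴ).symm⟩
  have hback : fromCols X Y = Z * Vᴴ := by
    rw [hZdef, Matrix.mul_assoc, hV, Matrix.mul_one]
  rw [hW, mul_fromCols] at hback
  obtain ⟨hX, hY⟩ := fromCols_inj hback
  have hWW : W₁ * W₁ᴴ + W₂ * W₂ᴴ = 1 := by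
    rw [← fromCols_mul_fromRows, ← conjTranspose_fromCols_eq_fromRows_conjTranspose, ← hW,
      conjTranspose_conjTranspose]
    exact mul_eq_one_comm.mp hV
  set E : Matrix _ _ ℂ := diagonal fun i => ((√(d i) : ℝ) : ℂ) with hE
  have hEE : E * E = Zᵀ * spinFlip * Z := by
    rw [hZ, hE, diagonal_mul_diagonal]
    congr 1
    ext i
    rw [← Complex.ofReal_mul, Real.mul_self_sqrt (hd i)]
  have hN : ∀ (W : Matrix ((Fin 2 × Fin 2) ⊕ (Fin 2 × Fin 2)) (Fin 2 × Fin 2) ℂ)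
      (X : Matrix (Fin 2 × Fin 2) (Fin 2 × Fin 2) ℂ), X = Z * W →
      (E * W)ᵀ * (E * W) = Xᵀ * spinFlip * X := by
    rintro W X rfl
    have hEt : Eᵀ = E := diagonal_transpose _
    rw [transpose_mul, hEt, transpose_mul]
    calc _ = Wᵀ * (E * E) * W := by simp only [Matrix.mul_assoc]
      _ = _ := by rw [hEE]; simp only [Matrix.mul_assoc]
  have h1 := two_mul_sub_trace_le_Lam X _ (hN W₁ X hX) j
  have h2 := two_mul_sub_trace_le_Lam Y _ (hN W₂ Y hY) j
  have hrow : ∀ i, ((E * W₁ * (E * W₁)ᴴ) i i).re + ((E * W₂ * (E * W₂)ᴴ) i i).re = d i := by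
    intro i
    have hEh : Eᴴ = E := by
      rw [hE, diagonal_conjTranspose]
      congr 1
      ext i
      simp
    rw [← Complex.add_re, ← Matrix.add_apply]
    have : E * W₁ * (E * W₁)ᴴ + E * W₂ * (E * W₂)ᴴ = E * (W₁ * W₁ᴴ + W₂ * W₂ᴴ) * E := by
      simp only [conjTranspose_mul, hEh, Matrix.mul_add, Matrix.add_mul, Matrix.mul_assoc]
    rw [this, hWW, Matrix.mul_one, hEE, hZ]
    simp
  rw [hsum, Lam_eq Z d hd hZ j hj]
  have h3 := Finset.sum_congr rfl fun i (_ : i ∈ Finset.univ) => hrow i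
  rw [Finset.sum_add_distrib] at h3
  linarith [hrow j]

theorem posSemidef_mul_diagonal_mul {ι : Type*} [Fintype ι] [DecidableEq ι]
    (Z : Matrix (Fin 2 × Fin 2) ι ℂ) (g : ι → ℝ) (hg : ∀ i, 0 ≤ g i) :
    (Z * diagonal (fun i => (g i : ℂ)) * Zᴴ).PosSemidef :=
  (PosSemidef.diagonal fun i => by simpa using hg i).mul_mul_conjTranspose_same Z

/-- Rescaling the columns of a diagonalizing `Z` rescales the `λ`s. -/
theorem Lam_mul_diagonal_mul {ι : Type*} [Fintype ι] [DecidableEq ι]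
    (Z : Matrix (Fin 2 × Fin 2) ι ℂ) (d : ι → ℝ) (hd : ∀ i, 0 ≤ d i)
    (hZ : Zᵀ * spinFlip * Z = diagonal fun i => (d i : ℂ)) (g : ι → ℝ) (hg : ∀ i, 0 ≤ g i)
    (j : ι) (hj : ∀ i, g i * d i ≤ g j * d j) :
    Lam (Z * diagonal (fun i => (g i : ℂ)) * Zᴴ) = 2 * (g j * d j) - ∑ i, g i * d i := by
  set E : Matrix ι ι ℂ := diagonal fun i => ((√(g i) : ℝ) : ℂ) with hE
  have hEt : Eᵀ = E := diagonal_transpose _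
  have hEh : Eᴴ = E := by
    rw [hE, diagonal_conjTranspose]
    congr 1
    ext i
    simp
  have hEE : E * E = diagonal fun i => (g i : ℂ) := by
    rw [hE, diagonal_mul_diagonal]
    congr 1
    ext i
    rw [← Complex.ofReal_mul, Real.mul_self_sqrt (hg i)]
  have h := Lam_eq (Z * E) (fun i => g i * d i) (fun i => mul_nonneg (hg i) (hd i)) ?_ j hj
  · rw [← h, ← hEE, conjTranspose_mul, hEh]
    simp only [Matrix.mul_assoc]
  · have : (Z * E)ᵀ * spinFlip * (Z * E) = E * (Zᵀ * spinFlip * Z) * E := by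
      rw [transpose_mul, hEt]
      simp only [Matrix.mul_assoc]
    rw [this, hZ, hE, diagonal_mul_diagonal, diagonal_mul_diagonal]
    congr 1
    ext i
    rw [mul_right_comm, ← Complex.ofReal_mul, Real.mul_self_sqrt (hg i)]
    push_cast
    rfl

theorem exists_spectral_decomposition {A : Op} (hA : A.PosSemidef) :
    ∃ (Z : Op) (d : Fin 2 × Fin 2 → ℝ), A = Z * Zᴴ ∧ (∀ i, 0 ≤ d i) ∧
      Zᵀ * spinFlip * Z = diagonal fun i => (d i : ℂ) := by
  obtain ⟨X, rfl⟩ := exists_eq_mul_conjTranspose hA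
  obtain ⟨V, d, -, hd, hX, -, hZ⟩ := exists_takagi_factor X
  exact ⟨X * V, d, hX.symm, hd, hZ⟩

theorem Lam_smul {A : Op} (hA : A.PosSemidef) {r : ℝ} (hr : 0 ≤ r) :
    Lam (r • A) = r * Lam A := by
  obtain ⟨Z, d, rfl, hd, hZ⟩ := exists_spectral_decomposition hA
  obtain ⟨j, hj⟩ := Finite.exists_max d
  have h := Lam_mul_diagonal_mul Z d hd hZ (fun _ => r) (fun _ => hr) j
    fun i => mul_le_mul_of_nonneg_left (hj i) hr
  have h1 : r • (Z * Zᴴ) = Z * diagonal (fun _ => (r : ℂ)) * Zᴴ := by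
    rw [← smul_one_eq_diagonal, Matrix.mul_smul, Matrix.mul_one, Matrix.smul_mul]
    exact (Complex.coe_smul r (Z * Zᴴ)).symm
  rw [h1, h, Lam_eq Z d hd hZ j hj, ← Finset.mul_sum]
  ring

/-! ### Separable states -/

theorem sigmaY_mul_transpose_mul (α : Matrix (Fin 2) (Fin 2) ℂ) :
    sigmaY * αᵀ * sigmaY = adjugate α := by
  rw [adjugate_fin_two]
  ext i j
  fin_cases i <;> fin_cases j <;>
    simp [sigmaY, mul_apply, vecMul, dotProduct, Fin.sum_univ_two,
      mul_right_comm Complex.I]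

/-- The spin-flip product of `α ⊗ β` is the scalar `det α det β`, so all four `λ`s agree. -/
theorem Lam_kronecker_nonpos {α β : Matrix (Fin 2) (Fin 2) ℂ} (hα : α.IsHermitian)
    (hβ : β.IsHermitian) : Lam (α ⊗ₖ β) ≤ 0 := by
  have key : ∀ {γ : Matrix (Fin 2) (Fin 2) ℂ}, γ.IsHermitian →
      γ * sigmaY * γ.map star * sigmaY = γ.det • 1 := fun {γ} hγ => by
    have h1 : γ.map star = γᵀ := by
      conv_rhs => rw [← hγ.eq]
      rfl
    rw [h1, ← mul_adjugate, ← sigmaY_mul_transpose_mul]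
    simp only [Matrix.mul_assoc]
  have hflip : spinFlipProduct (α ⊗ₖ β) = diagonal fun _ => α.det * β.det := by
    have hmap : (α ⊗ₖ β).map star = α.map star ⊗ₖ β.map star := by
      ext i j
      exact star_mul' _ _
    rw [spinFlipProduct, hmap, ← mul_kronecker_mul, ← mul_kronecker_mul, ← mul_kronecker_mul,
      key hα, key hβ, smul_kronecker, kronecker_smul, one_kronecker_one, smul_smul,
      smul_one_eq_diagonal]
  have h := Lam_eq_of_roots (α ⊗ₖ β) (fun _ : Fin 2 × Fin 2 => √(α.det * β.det).re)
    (fun _ => Real.sqrt_nonneg _) 0 (fun _ => le_rfl) 0 0 (by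
      rw [hflip, charpoly_diagonal,
        Polynomial.roots_prod _ _ (Polynomial.monic_prod_X_sub_C _ _).ne_zero]
      simp only [Polynomial.roots_X_sub_C, Multiset.bind_singleton, Multiset.map_map]
      rfl)
  rw [h]
  simp
  linarith [Real.sqrt_nonneg (α.det.re * β.det.re - α.det.im * β.det.im)]

theorem IsSeparable.posSemidef_and_Lam_nonpos {ρ : Op} (h : IsSeparable ρ) :
    ρ.PosSemidef ∧ Lam ρ ≤ 0 := by
  obtain ⟨n, p, α, β, hp, -, hα, hβ, rfl⟩ := h
  have hpsd : ∀ i, (α i ⊗ₖ β i).PosSemidef := fun i => (hα i).1.kronecker (hβ i).1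
  refine Finset.sum_induction _ (fun A : Op => A.PosSemidef ∧ Lam A ≤ 0) ?_ ?_ ?_
  · exact fun A B hA hB =>
      ⟨hA.1.add hB.1, (Lam_add_le hA.1 hB.1).trans (add_nonpos hA.2 hB.2)⟩
  · refine ⟨.zero, ?_⟩
    have := Lam_smul (PosSemidef.zero : (0 : Op).PosSemidef) le_rfl
    rw [zero_smul, zero_mul] at this
    exact this.le
  · intro i _
    refine ⟨(hpsd i).smul (hp i), ?_⟩
    rw [Lam_smul (hpsd i) (hp i)]
    exact mul_nonpos_of_nonneg_of_nonpos (hp i)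
      (Lam_kronecker_nonpos (hα i).1.isHermitian (hβ i).1.isHermitian)

theorem IsSeparable.trace_eq_one {ρ : Op} (h : IsSeparable ρ) : ρ.trace = 1 := by
  obtain ⟨n, p, α, β, -, hp, hα, hβ, rfl⟩ := h
  rw [trace_sum]
  simp only [trace_smul, trace_kronecker, (hα _).2, (hβ _).2, mul_one]
  rw [← Finset.sum_smul, hp, one_smul]

/-! ### The cost set -/

theorem neg_Lam_le_of_mem_costSet {ρ : Op} (hρ : IsSeparable ρ) {x : ℝ} (hx : x ∈ costSet ρ) :
    -Lam ρ ≤ x := by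
  obtain ⟨t, σ, ht, hσ, hmix, rfl⟩ := hx
  have hρ' := hρ.posSemidef_and_Lam_nonpos.1
  have hadd : (ρ + t • σ).PosSemidef := hρ'.add (hσ.1.1.smul ht.le)
  have hinv : 0 < (1 + t)⁻¹ := by positivity
  have h1 : 0 < Lam (mix ρ σ t) := (lt_max_iff.mp hmix).resolve_right (lt_irrefl 0)
  rw [mix, Lam_smul hadd hinv.le] at h1
  have h2 : 0 < Lam (ρ + t • σ) := pos_of_mul_pos_right h1 hinv.le
  have h3 := Lam_add_le hρ' (hσ.1.1.smul ht.le)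
  rw [Lam_smul hσ.1.1 ht.le] at h3
  have h4 : t * Lam σ ≤ t * concurrence σ := mul_le_mul_of_nonneg_left (le_max_left _ _) ht.le
  linarith

/-- It suffices to find unnormalized `B` that make `Λ(ρ + B)` positive: the normalization of `B` is
automatically entangled, since otherwise `Λ(ρ + B) ≤ Λ(ρ) + Λ(B) ≤ 0`. -/
theorem max_Lam_mem_costSet {ρ B : Op} (hρ : IsSeparable ρ) (hB : B.PosSemidef)
    (h : 0 < Lam (ρ + B)) : max (Lam B) 0 ∈ costSet ρ := by
  obtain ⟨hρ', hle⟩ := hρ.posSemidef_and_Lam_nonpos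
  have htr := Complex.le_def.mp hB.trace_nonneg
  obtain ⟨t, ht0, ht⟩ : ∃ t : ℝ, 0 ≤ t ∧ B.trace = t :=
    ⟨B.trace.re, htr.1, Complex.ext (by simp) (by simpa using htr.2.symm)⟩
  have htpos : 0 < t := by
    refine ht0.lt_of_ne fun h0 => ?_
    rw [← h0, Complex.ofReal_zero, hB.trace_eq_zero_iff] at ht
    rw [ht, add_zero] at h
    exact absurd h hle.not_gt
  have hinv : 0 < t⁻¹ := inv_pos.mpr htpos
  have hσ : Lam (t⁻¹ • B) = t⁻¹ * Lam B := Lam_smul hB hinv.le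
  have hBpos : 0 < Lam B := by linarith [Lam_add_le hρ' hB]
  refine ⟨t, t⁻¹ • B, htpos, ⟨⟨hB.smul hinv.le, ?_⟩, fun hsep => ?_⟩, ?_, ?_⟩
  · rw [trace_smul, ht, Complex.real_smul, ← Complex.ofReal_mul, inv_mul_cancel₀ htpos.ne',
      Complex.ofReal_one]
  · have := hsep.posSemidef_and_Lam_nonpos.2
    rw [hσ] at this
    exact absurd (mul_pos hinv hBpos) this.not_gt
  · have hinv' : 0 < (1 + t)⁻¹ := by positivity
    rw [concurrence, mix, smul_inv_smul₀ htpos.ne', Lam_smul (hρ'.add hB) hinv'.le]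
    exact lt_max_of_lt_left (mul_pos hinv' h)
  · rw [concurrence, hσ, mul_max_of_nonneg _ _ ht0, mul_inv_cancel_left₀ htpos.ne', mul_zero]

/-- If the largest `λ` is positive, a multiple `B` of the pure state given by the corresponding
column of `Z` raises `Λ` by exactly `Λ(B)`. -/
theorem exists_Lam_add_eq {ι : Type*} [Fintype ι] [DecidableEq ι]
    (Z : Matrix (Fin 2 × Fin 2) ι ℂ) (d : ι → ℝ) (hd : ∀ i, 0 ≤ d i)
    (hZ : Zᵀ * spinFlip * Z = diagonal fun i => (d i : ℂ)) (j : ι) (hj : ∀ i, d i ≤ d j)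
    (hpos : 0 < d j) {s : ℝ} (hs : 0 ≤ s) :
    ∃ B : Op, B.PosSemidef ∧ Lam B = s ∧ Lam (Z * Zᴴ + B) = Lam (Z * Zᴴ) + s := by
  have hr : 0 ≤ s / d j := by positivity
  have hg : ∀ i, 0 ≤ (Pi.single j (s / d j) : ι → ℝ) i := fun i => by
    rcases eq_or_ne i j with rfl | hij
    · simpa using hr
    · simp [hij]
  have hgd : ∀ i, (Pi.single j (s / d j) : ι → ℝ) i * d i = if i = j then s else 0 := fun i => by
    rcases eq_or_ne i j with rfl | hij
    · simp [hpos.ne']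
    · simp [hij]
  refine ⟨_, posSemidef_mul_diagonal_mul Z _ hg, ?_, ?_⟩
  · rw [Lam_mul_diagonal_mul Z d hd hZ _ hg j fun i => by
      rw [hgd, hgd]; split_ifs <;> simp_all]
    simp only [hgd]
    simp
    ring
  · have h := Lam_mul_diagonal_mul Z d hd hZ (fun i => 1 + (Pi.single j (s / d j) : ι → ℝ) i)
      (fun i => by linarith [hg i]) j fun i => by
        rw [add_mul, add_mul, hgd, hgd]
        split_ifs <;> simp_all
        linarith [hj i]
    have hsum : Z * Zᴴ + Z * diagonal (fun i => (((Pi.single j (s / d j) : ι → ℝ) i : ℝ) : ℂ)) * Zᴴ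
        = Z * diagonal (fun i => ((1 + (Pi.single j (s / d j) : ι → ℝ) i : ℝ) : ℂ)) * Zᴴ := by
      have : (diagonal fun i => ((1 + (Pi.single j (s / d j) : ι → ℝ) i : ℝ) : ℂ))
          = 1 + diagonal (fun i => (((Pi.single j (s / d j) : ι → ℝ) i : ℝ) : ℂ)) := by
        rw [← diagonal_one, diagonal_add]
        push_cast
        rfl
      rw [this, Matrix.mul_add, Matrix.add_mul, Matrix.mul_one]
    rw [hsum, h, Lam_eq Z d hd hZ j hj]
    simp only [add_mul, one_mul, hgd, Finset.sum_add_distrib]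
    simp
    ring

/-- The trace of the spin-flip product is the sum of the squares of the `λ`s. -/
theorem trace_spinFlipProduct {ι : Type*} [Fintype ι] [DecidableEq ι]
    (Z : Matrix (Fin 2 × Fin 2) ι ℂ) (d : ι → ℝ)
    (hZ : Zᵀ * spinFlip * Z = diagonal fun i => (d i : ℂ)) :
    (spinFlipProduct (Z * Zᴴ)).trace = ((∑ i, d i ^ 2 : ℝ) : ℂ) := by
  rw [spinFlipProduct_mul_conjTranspose, trace_mul_comm, Matrix.mul_assoc, hZ,
    diagonal_map (by simp), diagonal_mul_diagonal, trace_diagonal]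
  push_cast
  simp [sq]

theorem trace_spinFlipProduct_add_smul_one {ρ : Op} (hρ : ρ.trace = 1) (s : ℝ) :
    (spinFlipProduct (ρ + s • 1)).trace
      = (spinFlipProduct ρ).trace + ((2 * s + 4 * s ^ 2 : ℝ) : ℂ) := by
  have hmap : (ρ + s • (1 : Op)).map star = ρ.map star + (s : ℂ) • 1 := by
    ext i j
    by_cases h : i = j <;> simp [h, one_apply]
  have hρ' : (ρ.map star).trace = 1 := by
    have := congrArg star hρ
    simpa [Matrix.trace] using this
  have h1 : s • (1 : Op) = (s : ℂ) • 1 := by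
    ext i j
    simp [one_apply]
  have hexp : spinFlipProduct (ρ + s • 1) = spinFlipProduct ρ + (s : ℂ) • ρ
      + (s : ℂ) • (spinFlip * (ρ.map star * spinFlip)) + ((s : ℂ) * s) • 1 := by
    have hS : ∀ A : Op, spinFlip * (spinFlip * A) = A := fun A => by
      rw [← Matrix.mul_assoc, spinFlip_mul_self, Matrix.one_mul]
    unfold spinFlipProduct
    rw [hmap, h1]
    simp only [Matrix.mul_add, Matrix.add_mul, Matrix.smul_mul, Matrix.mul_smul, Matrix.mul_one,
      Matrix.one_mul, Matrix.mul_assoc, spinFlip_mul_self, smul_smul, smul_add]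
    abel
  rw [hexp, trace_add, trace_add, trace_add, trace_smul, trace_smul, trace_smul, trace_mul_comm,
    Matrix.mul_assoc, spinFlip_mul_self, Matrix.mul_one, hρ, hρ', trace_one]
  simp
  ring

/-- The bound `-Λ(ρ)` is approached. When all `λ`s of `ρ` vanish, `exists_Lam_add_eq` does not
apply to `ρ` itself; it is applied to `ρ + s` for a small `s > 0`, whose `λ`s are positive but
small because the sum of their squares is `2 s + 4 s²`. -/
theorem exists_posSemidef_Lam_add_pos {ρ : Op} (hρ : IsSeparable ρ) {ε : ℝ} (hε : 0 < ε) :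
    ∃ B : Op, B.PosSemidef ∧ 0 < Lam (ρ + B) ∧ Lam B ≤ -Lam ρ + ε := by
  obtain ⟨hpsd, hle⟩ := hρ.posSemidef_and_Lam_nonpos
  obtain ⟨Z, d, hZρ, hd, hZ⟩ := exists_spectral_decomposition hpsd
  obtain ⟨j, hj⟩ := Finite.exists_max d
  rcases (hd j).eq_or_lt with h0 | hpos
  · have hd0 : ∀ i, d i = 0 := fun i => le_antisymm (h0 ▸ hj i) (hd i)
    have hLam0 : Lam ρ = 0 := by
      rw [hZρ, Lam_eq Z d hd hZ j hj]
      simp [hd0]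
    -- With this choice `2 s + 4 s² ≤ 6 s ≤ (ε / 4)²` bounds the largest `λ` of `ρ + s` by `ε / 4`.
    set s := min 1 (ε ^ 2 / 96) with hs
    have hs0 : 0 < s := lt_min one_pos (by positivity)
    have hs1 : s ≤ 1 := min_le_left _ _
    have hsε : s ≤ ε ^ 2 / 96 := min_le_right _ _
    have hone : ((1 : Op)).PosSemidef := .one
    have hLam1 : Lam (1 : Op) ≤ 0 := by
      rw [← one_kronecker_one]
      exact Lam_kronecker_nonpos isHermitian_one isHermitian_one
    have hsone : (s • (1 : Op)).PosSemidef := hone.smul hs0.le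
    have hLams : Lam (s • (1 : Op)) ≤ 0 := by
      rw [Lam_smul hone hs0.le]
      exact mul_nonpos_of_nonneg_of_nonpos hs0.le hLam1
    have hLamρs : Lam (ρ + s • 1) ≤ 0 := (Lam_add_le hpsd hsone).trans (add_nonpos hle hLams)
    have htr := trace_spinFlipProduct_add_smul_one hρ.trace_eq_one s
    rw [hZρ, trace_spinFlipProduct Z d hZ, ← hZρ] at htr
    obtain ⟨Y, c, hY, hc, hYc⟩ := exists_spectral_decomposition (hpsd.add hsone)
    obtain ⟨l, hl⟩ := Finite.exists_max c
    rw [hY, trace_spinFlipProduct Y c hYc, ← Complex.ofReal_add, Complex.ofReal_inj] at htr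
    simp only [hd0] at htr
    norm_num at htr
    have hclt : c l ^ 2 ≤ (ε / 4) ^ 2 := by
      have := Finset.single_le_sum (fun i _ => sq_nonneg (c i)) (Finset.mem_univ l)
      beta_reduce at this
      nlinarith
    have hcle : c l ≤ ε / 4 := abs_le_of_sq_le_sq' hclt (by positivity) |>.2
    have hcpos : 0 < c l := by
      refine (hc l).lt_of_ne fun h => ?_
      have : ∀ i, c i = 0 := fun i => le_antisymm (h ▸ hl i) (hc i)
      simp [this] at htr
      nlinarith
    have hsum : ∑ i, c i ≤ 4 * c l := by
      have := Finset.sum_le_card_nsmul Finset.univ c (c l) fun i _ => hl i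
      simpa using this
    have hLamY := Lam_eq Y c hc hYc l hl
    obtain ⟨B, hB, hLamB, hadd⟩ := exists_Lam_add_eq Y c hc hYc l hl hcpos
      (s := -Lam (ρ + s • 1) + ε / 2) (by linarith)
    rw [← hY] at hadd hLamY
    refine ⟨s • 1 + B, hsone.add hB, ?_, ?_⟩
    · rw [← add_assoc, hadd]
      linarith
    · linarith [Lam_add_le hsone hB]
  · obtain ⟨B, hB, hLamB, hadd⟩ := exists_Lam_add_eq Z d hd hZ j hj hpos
      (s := -Lam ρ + ε) (by linarith)
    rw [← hZρ] at hadd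
    exact ⟨B, hB, by rw [hadd]; linarith, hLamB.le⟩

end TwoQubit

open TwoQubit

/-- For a separable two-qubit state the negative entanglement measure equals `Λ(ρ)`. The first
two conjuncts say that the infimum in its definition is a genuine one. -/
theorem theorem1 (ρ : TwoQubit.Op) (hρ : TwoQubit.IsSeparable ρ) :
    (TwoQubit.costSet ρ).Nonempty ∧ BddBelow (TwoQubit.costSet ρ) ∧
      TwoQubit.negEntanglement ρ = TwoQubit.Lam ρ := by
  have hlow : ∀ x ∈ costSet ρ, -Lam ρ ≤ x := fun x hx => neg_Lam_le_of_mem_costSet hρ hx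
  have happrox : ∀ ε > 0, ∃ x ∈ costSet ρ, x ≤ -Lam ρ + ε := fun ε hε => by
    obtain ⟨B, hB, hpos, hle⟩ := exists_posSemidef_Lam_add_pos hρ hε
    have := hρ.posSemidef_and_Lam_nonpos.2
    exact ⟨_, max_Lam_mem_costSet hρ hB hpos, max_le hle (by linarith)⟩
  have hne : (costSet ρ).Nonempty := by
    obtain ⟨x, hx, -⟩ := happrox 1 one_pos
    exact ⟨x, hx⟩
  have hbdd : BddBelow (costSet ρ) := ⟨_, hlow⟩
  refine ⟨hne, hbdd, ?_⟩
  have h1 : sInf (costSet ρ) ≤ -Lam ρ := le_of_forall_pos_le_add fun ε hε => by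
    obtain ⟨x, hx, hle⟩ := happrox ε hε
    exact (csInf_le hbdd hx).trans hle
  rw [negEntanglement, le_antisymm h1 (le_csInf hne hlow), neg_neg]
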